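/- Let $Q(x_1,\dots,x_r)=\sum_{1\le i\le j\le r} a_{ij}x_ix_j$ be a quadratic form in $r$ variables with integer coefficients $a_{ij}$. Assume that $Q$ is primitive (no integer $k>1$ divides all the $a_{ij}$) and nonsingular over $\mathbb{Q}$ (that is, $\det A\neq 0$, where $A$ is the symmetric $r\times r$ matrix with $Q(x)=\tfrac12 x^{T}Ax$). Let $p$ be a prime number and let $$R(Q)=\left\{\frac{Q(x)}{Q(y)} : x,y\in\mathbb{Z}^r,\ Q(y)\neq 0\right\}.$$ (a) If $r=2$ and $Q(x,y)=ax^2+bxy+cy^2$, then $R(Q)$ is dense in $\mathbb{Q}_p$ if and only if the discriminant $b^2-4ac$ is a square in $\mathbb{Q}_p$. (b) If $r\ge 3$, then $R(Q)$ is dense in $\mathbb{Q}_p$. -/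

import Mathlib

/-! Integral quadratic forms in `r` variables are Mathlib's `QuadraticForm ℤ (Fin r → ℤ)`. -/

namespace IntForm

variable {r : ℕ}

/-- The integer coefficient `a_{ij}` of the form `Q = ∑_{i ≤ j} a_{ij} x_i x_j`
(it is used for `i ≤ j` only): `Q(e_i)` on the diagonal, and
`Q(e_i + e_j) - Q(e_i) - Q(e_j)` off the diagonal. -/
def coeff (Q : QuadraticForm ℤ (Fin r → ℤ)) (i j : Fin r) : ℤ :=
  if i = j then Q (Pi.single i 1)
  else QuadraticMap.polar Q (Pi.single i 1) (Pi.single j 1)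

/-- The form is the homogeneous polynomial of degree two with the coefficients `coeff Q i j`. -/
theorem apply_eq_sum (Q : QuadraticForm ℤ (Fin r → ℤ)) (x : Fin r → ℤ) :
    Q x = ∑ i, ∑ j ∈ Finset.Ici i, coeff Q i j * x i * x j := by
  have h := congrArg (fun q : QuadraticForm ℤ (Fin r → ℤ) => q x)
    (QuadraticMap.toQuadraticMap_toBilin Q (Pi.basisFun ℤ (Fin r)))
  simp only [LinearMap.BilinMap.toQuadraticMap_apply] at h
  rw [← h, ← LinearMap.sum_repr_mul_repr_mul (Pi.basisFun ℤ (Fin r)) (Pi.basisFun ℤ (Fin r)),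
    Finsupp.sum_fintype _ _ (by simp)]
  refine Finset.sum_congr rfl fun i _ => ?_
  rw [Finsupp.sum_fintype _ _ (by simp)]
  rw [← Finset.sum_subset (Finset.subset_univ (Finset.Ici i))]
  · refine Finset.sum_congr rfl fun j hj => ?_
    have hij : i ≤ j := Finset.mem_Ici.mp hj
    rcases hij.eq_or_lt with rfl | hlt
    · rw [QuadraticMap.toBilin_apply]
      simp [coeff]
      ring
    · rw [QuadraticMap.toBilin_apply]
      simp [coeff, hlt, hlt.ne]
      ring
  · intro j _ hj
    have hji : j < i := by simpa using hj
    rw [QuadraticMap.toBilin_apply]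
    simp [hji.ne', hji.not_gt]

/-- `Q` is primitive: no integer `k > 1` divides all of its coefficients. -/
def IsPrimitive (Q : QuadraticForm ℤ (Fin r → ℤ)) : Prop :=
  ¬ ∃ k : ℕ, 1 < k ∧ ∀ i j : Fin r, i ≤ j → (k : ℤ) ∣ coeff Q i j

/-- The symmetric integer matrix `A` (with even diagonal) such that `Q(x) = (1/2) xᵀ A x`. -/
def matrix (Q : QuadraticForm ℤ (Fin r → ℤ)) : Matrix (Fin r) (Fin r) ℤ :=
  Matrix.of fun i j => QuadraticMap.polar Q (Pi.single i 1) (Pi.single j 1)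

/-- `Q` is nonsingular over the field `F`: the determinant of its matrix is nonzero in `F`. -/
def IsNonsingularOver (F : Type*) [Field F] (Q : QuadraticForm ℤ (Fin r → ℤ)) : Prop :=
  ((matrix Q).map (Int.cast : ℤ → F)).det ≠ 0

/-- The discriminant `b² - 4ac` of the binary form `a x² + b x y + c y²`. -/
def discriminant (Q : QuadraticForm ℤ (Fin 2 → ℤ)) : ℤ :=
  coeff Q 0 1 ^ 2 - 4 * coeff Q 0 0 * coeff Q 1 1

/-- The ratio set `R(Q) = {Q(x)/Q(y) : x, y ∈ ℤʳ, Q(y) ≠ 0}`, a set of rational numbers. -/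
def ratioSet (Q : QuadraticForm ℤ (Fin r → ℤ)) : Set ℚ :=
  {t | ∃ x y : Fin r → ℤ, Q y ≠ 0 ∧ t = (Q x : ℚ) / (Q y : ℚ)}

/-- The ratio set is dense in the field of `p`-adic numbers. -/
def RatioSetDense (p : ℕ) [Fact p.Prime] (Q : QuadraticForm ℤ (Fin r → ℤ)) : Prop :=
  Dense ((fun t : ℚ => (t : ℚ_[p])) '' ratioSet Q)

end IntForm

/-!
Square classes in `ℚ_[p]` are open, and `Q (u y) = u² Q y`. Therefore the ratio set of `Q` is dense in
`ℚ_[p]` exactly when every nonzero `t` is a ratio `Q(x) / Q(y)` of values at `p`-adic vectors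
(`IntForm.ratioSetDense_of_forall_ratio`, `IntForm.RatioSetDense.exists_ratio`). If `Q` is isotropic
over `ℚ_[p]`, it is universal by nonsingularity, and the ratio set is dense.

For `r ≥ 3` and anisotropic `Q`, the form `Q(x) - t Q(y)` has at least six variables, and a form over
`ℚ_[p]` in at least five variables is isotropic
(`QuadraticForm.finrank_le_four_of_anisotropic`). The proof of the latter is uniform in `p`, the
prime `2` included, and does not diagonalise. By Hensel's lemma an anisotropic form `q` satisfies
`‖polar q x y‖² ≤ ‖q x‖ ‖q y‖`, so that `√‖q x‖` is an ultrametric norm. A basis that is orthogonal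
for this norm exists, because best approximations in subspaces do. After rescaling, its members
have one of two lengths, and at most two have the same length: by the Chevalley–Warning theorem
three vectors of equal length are dependent in the reduction of `q` modulo `p`.

A binary form whose discriminant `d` is a square is isotropic. If `d` is not a square, then ratios of
values of `Q` have the form `X² - d Y²`, and these miss some `t`
(`Padic.exists_sq_sub_mul_sq_ne`): with `d` of valuation `0` or `1`, a `t` can be chosen for which
`t Z² = X² - d Y²` has no primitive solution, by congruences modulo `p²`, or modulo `8` if `p = 2`.
-/

/-! ### Hensel's lemma for two quadratic equations -/

open Polynomial in
theorem PadicInt.isSquare_of_norm_sub_lt {p : ℕ} [Fact p.Prime] {u a : ℤ_[p]}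
    (h : ‖a ^ 2 - u‖ < ‖2 * a‖ ^ 2) : IsSquare u := by
  have hF : ‖(X ^ 2 - C u : ℤ_[p][X]).aeval a‖ <
      ‖(derivative (X ^ 2 - C u : ℤ_[p][X])).aeval a‖ ^ 2 := by
    simpa [one_add_one_eq_two] using h
  obtain ⟨z, hz, -⟩ := hensels_lemma hF
  refine ⟨z, ?_⟩
  have : z ^ 2 - u = 0 := by simpa using hz
  linear_combination -this

open Polynomial in
/-- The root `w` is close to `1`, where the derivative `2 c w - 1` is a unit even for `p = 2`. -/
theorem PadicInt.exists_mul_sq_sub_add_one_eq_zero {p : ℕ} [Fact p.Prime] {c : ℤ_[p]}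
    (h : ‖c‖ < 1) : ∃ w : ℤ_[p], c * w ^ 2 - w + 1 = 0 := by
  have hd : ‖c * 2 - 1‖ = 1 := by
    have h2 : ‖c * 2‖ < 1 := by
      rw [norm_mul]
      exact (mul_le_of_le_one_right (norm_nonneg _) (PadicInt.norm_le_one 2)).trans_lt h
    have := PadicInt.norm_add_eq_max_of_ne (q := c * 2) (r := -1) (by simpa using h2.ne)
    rw [sub_eq_add_neg, this]
    simpa using h2.le
  have hF : ‖(C c * X ^ 2 - X + 1 : ℤ_[p][X]).aeval (1 : ℤ_[p])‖ <
      ‖(derivative (C c * X ^ 2 - X + 1 : ℤ_[p][X])).aeval (1 : ℤ_[p])‖ ^ 2 := by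
    simpa [one_add_one_eq_two, hd] using h
  obtain ⟨z, hz, -⟩ := hensels_lemma hF
  exact ⟨z, by simpa using hz⟩

/-! ### Anisotropic forms over `ℚ_[p]` are ultrametric -/

namespace QuadraticForm

variable {p : ℕ} [Fact p.Prime] {V : Type*} [AddCommGroup V] [Module ℚ_[p] V]
  {q : QuadraticForm ℚ_[p] V}

/-- A Cauchy–Schwarz inequality for anisotropic forms over `ℚ_[p]`. If it failed, Hensel's lemma
would solve `q (s • x + y) = 0` for `s`. -/
theorem norm_polar_sq_le (hq : q.Anisotropic) (x y : V) :
    ‖QuadraticMap.polar q x y‖ ^ 2 ≤ ‖q x‖ * ‖q y‖ := by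
  by_contra! hlt
  set b := QuadraticMap.polar q x y with hb
  have hb0 : b ≠ 0 := by
    intro h
    rw [h] at hlt
    simp only [norm_zero] at hlt
    nlinarith [mul_nonneg (norm_nonneg (q x)) (norm_nonneg (q y))]
  have hbpos : 0 < ‖b‖ ^ 2 := by positivity
  have hc : ‖q x * q y / b ^ 2‖ < 1 := by
    rw [norm_div, norm_mul, norm_pow, div_lt_one hbpos]
    exact hlt
  obtain ⟨w, hw⟩ := PadicInt.exists_mul_sq_sub_add_one_eq_zero
    (c := (⟨q x * q y / b ^ 2, hc.le⟩ : ℤ_[p])) (by simpa using hc)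
  have hw' : q x * q y / b ^ 2 * (w : ℚ_[p]) ^ 2 - w + 1 = 0 := by
    have := congrArg (fun z : ℤ_[p] => (z : ℚ_[p])) hw
    push_cast at this
    exact this
  -- in terms of `w = -s b / q y` the equation `q (s • x + y) = 0` becomes `c w² - w + 1 = 0`
  -- with `c = q x * q y / b²`
  set s : ℚ_[p] := -(q y / b) * w with hs
  have hroot : q (s • x + y) = 0 := by
    rw [QuadraticMap.map_add q, QuadraticMap.map_smul, QuadraticMap.polar_smul_left, ← hb,
      smul_eq_mul, smul_eq_mul]
    have : s * s * q x + q y + s * b = q y * (q x * q y / b ^ 2 * (w : ℚ_[p]) ^ 2 - w + 1) := by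
      rw [hs]; field_simp; ring
    rw [this, hw', mul_zero]
  -- anisotropy now makes `y` a multiple of `x`, and then `b² = 4 * q x * q y`
  have hy : y = -(s • x) := (neg_eq_of_add_eq_zero_right (hq _ hroot)).symm
  have hqy : q y = s * s * q x := by
    rw [hy, QuadraticMap.map_neg, QuadraticMap.map_smul, smul_eq_mul]
  have hbx : b = -(s * (2 * q x)) := by
    rw [hb, hy, QuadraticMap.polar_neg_right, QuadraticMap.polar_smul_right,
      QuadraticMap.polar_self, smul_eq_mul, two_smul, two_mul]
  have hb2 : ‖b‖ ^ 2 = ‖(2 : ℚ_[p])‖ ^ 2 * (‖q x‖ * ‖q y‖) := by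
    rw [hqy, hbx]; simp only [norm_neg, norm_mul]; ring
  have h2 : ‖(2 : ℚ_[p])‖ ≤ 1 := by simpa using Padic.norm_int_le_one (p := p) 2
  have h2' : ‖(2 : ℚ_[p])‖ ^ 2 ≤ 1 := pow_le_one₀ (norm_nonneg _) h2
  have := mul_le_of_le_one_left (mul_nonneg (norm_nonneg (q x)) (norm_nonneg (q y))) h2'
  linarith

theorem norm_polar_le_max (hq : q.Anisotropic) (x y : V) :
    ‖QuadraticMap.polar q x y‖ ≤ max ‖q x‖ ‖q y‖ := by
  refine le_of_pow_le_pow_left₀ two_ne_zero (le_max_of_le_left (norm_nonneg _))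
    ((norm_polar_sq_le hq x y).trans ?_)
  rw [sq]
  gcongr
  · exact le_max_left _ _
  · exact le_max_right _ _

/-- `√‖q x‖` satisfies the ultrametric inequality. -/
theorem norm_add_le_max (hq : q.Anisotropic) (x y : V) :
    ‖q (x + y)‖ ≤ max ‖q x‖ ‖q y‖ := by
  rw [QuadraticMap.map_add q]
  exact (Padic.nonarchimedean _ _).trans
    (max_le (Padic.nonarchimedean _ _) (norm_polar_le_max hq x y))

end QuadraticForm

/-! ### Three vectors in the unit ball are dependent modulo `p` -/

open MvPolynomial in
/-- A ternary quadratic form over a finite field is isotropic, by the Chevalley–Warning theorem. -/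
theorem FiniteField.exists_ternary_quadratic_zero {K : Type*} [Field K] [Fintype K]
    (a₀ a₁ a₂ b₀₁ b₀₂ b₁₂ : K) :
    ∃ c : Fin 3 → K, c ≠ 0 ∧ a₀ * c 0 ^ 2 + a₁ * c 1 ^ 2 + a₂ * c 2 ^ 2 +
      b₀₁ * (c 0 * c 1) + b₀₂ * (c 0 * c 2) + b₁₂ * (c 1 * c 2) = 0 := by
  classical
  obtain ⟨ℓ, hℓ⟩ := CharP.exists K
  have : Fact ℓ.Prime := ⟨CharP.char_is_prime K ℓ⟩
  let f : MvPolynomial (Fin 3) K := C a₀ * X 0 ^ 2 + C a₁ * X 1 ^ 2 + C a₂ * X 2 ^ 2 +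
      C b₀₁ * (X 0 * X 1) + C b₀₂ * (X 0 * X 2) + C b₁₂ * (X 1 * X 2)
  have hmul (a : K) (g : MvPolynomial (Fin 3) K) (hg : g.totalDegree ≤ 2) :
      (C a * g).totalDegree ≤ 2 := by
    refine (totalDegree_mul _ _).trans ?_
    simpa using hg
  have hXX (i j : Fin 3) : (X i * X j : MvPolynomial (Fin 3) K).totalDegree ≤ 2 :=
    (totalDegree_mul _ _).trans (by simp)
  have hX (i : Fin 3) : (X i ^ 2 : MvPolynomial (Fin 3) K).totalDegree ≤ 2 := by
    simp
  have hf : f.totalDegree ≤ 2 := by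
    refine (totalDegree_add _ _).trans (max_le ?_ (hmul _ _ (hXX _ _)))
    refine (totalDegree_add _ _).trans (max_le ?_ (hmul _ _ (hXX _ _)))
    refine (totalDegree_add _ _).trans (max_le ?_ (hmul _ _ (hXX _ _)))
    refine (totalDegree_add _ _).trans (max_le ?_ (hmul _ _ (hX _)))
    exact (totalDegree_add _ _).trans (max_le (hmul _ _ (hX _)) (hmul _ _ (hX _)))
  have hdvd := char_dvd_card_solutions ℓ (f := f) (by simp; omega)
  have h0 : eval (0 : Fin 3 → K) f = 0 := by simp [f]
  have hcard : 1 < Fintype.card {x : Fin 3 → K // eval x f = 0} :=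
    lt_of_lt_of_le (Fact.out : ℓ.Prime).one_lt
      (Nat.le_of_dvd (Fintype.card_pos_iff.2 ⟨⟨0, h0⟩⟩) hdvd)
  obtain ⟨⟨c, hc⟩, hne⟩ := Fintype.exists_ne_of_one_lt_card hcard ⟨0, h0⟩
  exact ⟨c, fun h => hne (Subtype.ext h), by simpa [f] using hc⟩

namespace QuadraticForm

variable {p : ℕ} [Fact p.Prime] {V : Type*} [AddCommGroup V] [Module ℚ_[p] V]
  {q : QuadraticForm ℚ_[p] V}

/-- By `norm_polar_le_max` the form `q` has integral coefficients on the span of the `x i`, so it can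
be reduced modulo `p`; the combination lifts an isotropic vector of the reduction. -/
theorem exists_norm_combination_lt_one (hq : q.Anisotropic) (x : Fin 3 → V)
    (hx : ∀ i, ‖q (x i)‖ ≤ 1) :
    ∃ c : Fin 3 → ℤ_[p], (∃ i, ‖c i‖ = 1) ∧ ‖q (∑ i, (c i : ℚ_[p]) • x i)‖ < 1 := by
  have hB (i j) : ‖QuadraticMap.polar q (x i) (x j)‖ ≤ 1 :=
    (norm_polar_le_max hq _ _).trans (max_le (hx i) (hx j))
  let a (i) : ℤ_[p] := ⟨q (x i), hx i⟩
  let b (i j) : ℤ_[p] := ⟨QuadraticMap.polar q (x i) (x j), hB i j⟩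
  obtain ⟨d, hd0, hd⟩ := FiniteField.exists_ternary_quadratic_zero
    (PadicInt.toZMod (a 0)) (PadicInt.toZMod (a 1)) (PadicInt.toZMod (a 2))
    (PadicInt.toZMod (b 0 1)) (PadicInt.toZMod (b 0 2)) (PadicInt.toZMod (b 1 2))
  choose c hc using fun i => ZMod.ringHom_surjective (PadicInt.toZMod (p := p)) (d i)
  have hlt (z : ℤ_[p]) : ‖z‖ < 1 ↔ PadicInt.toZMod z = 0 := by
    rw [← RingHom.mem_ker, PadicInt.ker_toZMod, ← PadicInt.mem_nonunits,
      IsLocalRing.mem_maximalIdeal]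
  refine ⟨c, ?_, ?_⟩
  · obtain ⟨i, hi⟩ := Function.ne_iff.1 hd0
    refine ⟨i, le_antisymm (PadicInt.norm_le_one _) (not_lt.1 fun h => hi ?_)⟩
    rw [← hc, (hlt _).1 h, Pi.zero_apply]
  · have key : PadicInt.toZMod (a 0 * c 0 ^ 2 + a 1 * c 1 ^ 2 + a 2 * c 2 ^ 2 +
        b 0 1 * (c 0 * c 1) + b 0 2 * (c 0 * c 2) + b 1 2 * (c 1 * c 2)) = 0 := by
      simpa [hc] using hd
    rw [← hlt, PadicInt.norm_def] at key
    convert key using 2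
    rw [Fin.sum_univ_three, QuadraticMap.map_add q, QuadraticMap.map_add q]
    simp only [QuadraticMap.map_smul,
      QuadraticMap.polar_add_left, QuadraticMap.polar_smul_left, QuadraticMap.polar_smul_right,
      smul_eq_mul]
    push_cast
    simp only [a, b]
    ring

end QuadraticForm

/-! ### Orthogonal families and the bound on the dimension -/

namespace QuadraticForm

variable {p : ℕ} [Fact p.Prime] {V : Type*} [AddCommGroup V] [Module ℚ_[p] V]
  {q : QuadraticForm ℚ_[p] V}

/-- A family of nonzero vectors that is orthogonal for the ultrametric norm `√‖q x‖`: no term of a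
linear combination is longer than the combination. (For `p = 2` this is not implied by orthogonality
for the polar form, as `X² + Y²` shows.) -/
def IsNormOrthogonal (q : QuadraticForm ℚ_[p] V) {n : ℕ} (x : Fin n → V) : Prop :=
  (∀ i, x i ≠ 0) ∧ ∀ (c : Fin n → ℚ_[p]) (i : Fin n), ‖q (c i • x i)‖ ≤ ‖q (∑ j, c j • x j)‖

/-- Best approximation in a subspace exists: with the norm `√‖q x‖` the space is a finite-dimensional
normed space over the locally compact field `ℚ_[p]`, hence proper. -/
theorem exists_norm_le_of_submodule [FiniteDimensional ℚ_[p] V] (hq : q.Anisotropic)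
    (W : Submodule ℚ_[p] V) (v : V) : ∃ w ∈ W, ∀ w' ∈ W, ‖q (v - w)‖ ≤ ‖q (v - w')‖ := by
  let : Norm V := ⟨fun x => √‖q x‖⟩
  have hN (x : V) : ‖x‖ = √‖q x‖ := rfl
  have core : NormedSpace.Core ℚ_[p] V :=
    { norm_nonneg := fun x => Real.sqrt_nonneg _
      norm_smul := fun c x => by
        rw [hN, hN, QuadraticMap.map_smul, smul_eq_mul, norm_mul, norm_mul,
          Real.sqrt_mul (by positivity), Real.sqrt_mul_self (norm_nonneg _)]
      norm_triangle := fun x y => by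
        have h := Real.sqrt_le_sqrt (norm_add_le_max hq x y)
        rw [Monotone.map_max (f := Real.sqrt) fun _ _ => Real.sqrt_le_sqrt] at h
        exact h.trans (max_le_add_of_nonneg (Real.sqrt_nonneg _) (Real.sqrt_nonneg _))
      norm_eq_zero_iff := fun x => by
        rw [hN, Real.sqrt_eq_zero (norm_nonneg _), norm_eq_zero]
        exact hq.eq_zero_iff }
  let : NormedAddCommGroup V := NormedAddCommGroup.ofCore core
  let : NormedSpace ℚ_[p] V := NormedSpace.ofCore core
  have : ProperSpace V := FiniteDimensional.proper ℚ_[p] V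
  obtain ⟨w, hw, hd⟩ := (W.closed_of_finiteDimensional).exists_infDist_eq_dist ⟨0, W.zero_mem⟩ v
  refine ⟨w, hw, fun w' hw' => ?_⟩
  have h : dist v w ≤ dist v w' := hd ▸ Metric.infDist_le_dist_of_mem hw'
  rw [dist_eq_norm, dist_eq_norm] at h
  exact (Real.sqrt_le_sqrt_iff (norm_nonneg _)).1 h

theorem IsNormOrthogonal.exists_cons [FiniteDimensional ℚ_[p] V] (hq : q.Anisotropic) {n : ℕ}
    {x : Fin n → V} (hx : IsNormOrthogonal q x) (hn : n < Module.finrank ℚ_[p] V) :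
    ∃ u : V, IsNormOrthogonal q (Fin.cons u x : Fin (n + 1) → V) := by
  set W := Submodule.span ℚ_[p] (Set.range x) with hW
  have hWtop : W ≠ ⊤ := by
    intro h
    have := finrank_range_le_card (R := ℚ_[p]) x
    rw [Set.finrank, ← hW, h, finrank_top, Fintype.card_fin] at this
    omega
  obtain ⟨v, -, hv⟩ := SetLike.exists_of_lt hWtop.lt_top
  obtain ⟨w, hw, hmin⟩ := exists_norm_le_of_submodule hq W v
  have hu0 : v - w ≠ 0 := fun h => hv (by rwa [sub_eq_zero.1 h])
  -- homogeneity turns minimality of `v - w` into orthogonality of all its multiples to `W`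
  have horth (a : ℚ_[p]) (z : V) (hz : z ∈ W) : ‖q (a • (v - w))‖ ≤ ‖q (a • (v - w) + z)‖ := by
    rcases eq_or_ne a 0 with rfl | ha
    · simp
    · have h := hmin (w - a⁻¹ • z) (W.sub_mem hw (W.smul_mem _ hz))
      have e : a • (v - w) + z = a • (v - (w - a⁻¹ • z)) := by
        simp only [smul_sub, smul_inv_smul₀ ha]; abel
      rw [e, QuadraticMap.map_smul, QuadraticMap.map_smul, smul_eq_mul, smul_eq_mul]
      simp only [norm_mul]
      gcongr
  refine ⟨v - w, fun i => ?_, fun c i => ?_⟩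
  · refine Fin.cases ?_ (fun j => ?_) i
    · simpa using hu0
    · simpa using hx.1 j
  · rw [Fin.sum_univ_succ]
    simp only [Fin.cons_zero, Fin.cons_succ]
    set z := ∑ j : Fin n, c j.succ • x j with hz
    have hzW : z ∈ W := Submodule.sum_mem _ fun j _ =>
      W.smul_mem _ (Submodule.subset_span ⟨j, rfl⟩)
    refine Fin.cases ?_ (fun j => ?_) i
    · simpa using horth (c 0) z hzW
    · rw [Fin.cons_succ]
      refine (hx.2 (fun j => c j.succ) j).trans ?_
      rw [← hz]
      have h := norm_add_le_max hq (c 0 • (v - w) + z) (-(c 0 • (v - w)))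
      rw [add_neg_cancel_comm, QuadraticMap.map_neg] at h
      exact h.trans (max_le le_rfl (horth (c 0) z hzW))

theorem exists_isNormOrthogonal [FiniteDimensional ℚ_[p] V] (hq : q.Anisotropic) (n : ℕ)
    (hn : n ≤ Module.finrank ℚ_[p] V) : ∃ x : Fin n → V, IsNormOrthogonal q x := by
  induction n with
  | zero => exact ⟨Fin.elim0, fun i => i.elim0, fun _ i => i.elim0⟩
  | succ n ih =>
    obtain ⟨x, hx⟩ := ih (by omega)
    obtain ⟨u, hu⟩ := hx.exists_cons hq (by omega)
    exact ⟨_, hu⟩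

/-- An orthogonal family has at most two vectors of any given length: a combination of three of them
that is shorter than its longest term exists by reduction modulo `p`. -/
theorem not_isNormOrthogonal_of_norm_eq (hq : q.Anisotropic) {n : ℕ} {x : Fin n → V}
    (hx : IsNormOrthogonal q x) {f : Fin 3 → Fin n} (hf : Function.Injective f) {a : ℚ_[p]}
    (ha : a ≠ 0) (h : ∀ i, ‖q (x (f i))‖ = ‖a‖) : False := by
  have ha' : ‖a‖ ≠ 0 := norm_ne_zero_iff.2 ha
  have hqa : (a⁻¹ • q).Anisotropic := fun v hv => hq v (by simpa [ha] using hv)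
  obtain ⟨c, ⟨i, hi⟩, hc⟩ := exists_norm_combination_lt_one hqa (x ∘ f) fun i => by
    simp [h, ha']
  let e : Fin n → ℚ_[p] := Function.extend f (fun j => (c j : ℚ_[p])) 0
  have he (j) : e (f j) = c j := hf.extend_apply _ _ _
  have hsum : ∑ j, e j • x j = ∑ j, (c j : ℚ_[p]) • (x ∘ f) j := by
    rw [← Finset.sum_subset (Finset.subset_univ (Finset.univ.image f)),
      Finset.sum_image fun _ _ _ _ h => hf h]
    · simp [he]
    · intro j _ hj
      have : ¬ ∃ i, f i = j := by simpa using hj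
      simp [e, Function.extend_apply' _ _ _ this]
  have h1 := hx.2 e (f i)
  rw [hsum, he, QuadraticMap.map_smul, smul_eq_mul, norm_mul, norm_mul, h, ← PadicInt.norm_def, hi,
    one_mul, one_mul] at h1
  rw [smul_apply, smul_eq_mul, norm_mul, norm_inv, inv_mul_lt_iff₀ (by positivity),
    mul_one] at hc
  exact absurd hc h1.not_gt

/-- A quadratic form in at least five variables over `ℚ_[p]` is isotropic. -/
theorem finrank_le_four_of_anisotropic [FiniteDimensional ℚ_[p] V] (hq : q.Anisotropic) :
    Module.finrank ℚ_[p] V ≤ 4 := by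
  by_contra! h5
  obtain ⟨x, hx⟩ := exists_isNormOrthogonal hq 5 h5
  have hp0 : (p : ℚ_[p]) ≠ 0 := by exact_mod_cast (Fact.out : p.Prime).ne_zero
  have hx0 (i) : q (x i) ≠ 0 := fun h => hx.1 i (hq _ h)
  -- rescaling by powers of `p` brings every `q (x i)` to valuation `0` or `1`; of five vectors,
  -- three share the same one
  let k (i) : ℤ := -((q (x i)).valuation / 2)
  let y (i) : V := (p : ℚ_[p]) ^ k i • x i
  have hy : IsNormOrthogonal q y := by
    refine ⟨fun i => smul_ne_zero (zpow_ne_zero _ hp0) (hx.1 i), fun c i => ?_⟩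
    simpa [y, smul_smul] using hx.2 (fun j => c j * (p : ℚ_[p]) ^ k j) i
  have hval (i) : (q (y i)).valuation = (q (x i)).valuation % 2 := by
    simp only [y, QuadraticMap.map_smul, smul_eq_mul]
    rw [Padic.valuation_mul (by simp [zpow_ne_zero _ hp0]) (hx0 i),
      Padic.valuation_mul (zpow_ne_zero _ hp0) (zpow_ne_zero _ hp0)]
    simp only [Padic.valuation_zpow, Padic.valuation_p, k]
    omega
  have hy0 (i) : q (y i) ≠ 0 := fun h => hy.1 i (hq _ h)
  obtain ⟨m, hm, hcard⟩ := Finset.exists_lt_card_fiber_of_mul_lt_card_of_maps_to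
    (s := (Finset.univ : Finset (Fin 5))) (t := ({0, 1} : Finset ℤ)) (n := 2)
    (f := fun i => (q (x i)).valuation % 2) (fun i _ => by simp; omega) (by simp)
  obtain ⟨s, hs, hs3⟩ := Finset.exists_subset_card_eq hcard
  refine not_isNormOrthogonal_of_norm_eq hq hy (f := s.orderEmbOfFin hs3)
    (s.orderEmbOfFin hs3).injective (a := (p : ℚ_[p]) ^ m) (zpow_ne_zero _ hp0) fun i => ?_
  have hi := hs (s.orderEmbOfFin_mem hs3 i)
  rw [Padic.norm_eq_zpow_neg_valuation (hy0 _), hval, (Finset.mem_filter.1 hi).2, Padic.norm_p_zpow]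

end QuadraticForm

/-! ### Integral forms over a field -/

namespace QuadraticForm

/-- An isotropic vector outside the radical makes a form universal: on the line `s • x + w` the form
is affine in `s` and not constant. -/
theorem exists_eq_of_isotropic {K V : Type*} [Field K] [AddCommGroup V] [Module K V]
    {q : QuadraticForm K V} {x w : V} (hx : q x = 0) (hw : QuadraticMap.polar q x w ≠ 0) (t : K) :
    ∃ v, q v = t := by
  refine ⟨((t - q w) / QuadraticMap.polar q x w) • x + w, ?_⟩
  rw [QuadraticMap.map_add q, QuadraticMap.map_smul, QuadraticMap.polar_smul_left, hx, smul_zero,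
    zero_add, smul_eq_mul, div_mul_cancel₀ _ hw, add_sub_cancel]

end QuadraticForm

namespace IntForm

variable {r : ℕ}

/-- The upper triangular matrix of the coefficients `a_{ij}`, `i ≤ j`. Unlike half of the symmetric
matrix, it is integral. -/
def upperMatrix (Q : QuadraticForm ℤ (Fin r → ℤ)) : Matrix (Fin r) (Fin r) ℤ :=
  Matrix.of fun i j => if i ≤ j then coeff Q i j else 0

theorem upperMatrix_add_transpose (Q : QuadraticForm ℤ (Fin r → ℤ)) :
    upperMatrix Q + (upperMatrix Q).transpose = matrix Q := by
  ext i j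
  rcases lt_trichotomy i j with h | rfl | h
  · simp [upperMatrix, matrix, coeff, h.le, h.ne, h.not_ge]
  · simp [upperMatrix, matrix, coeff]; ring
  · simp [upperMatrix, matrix, coeff, h.le, h.ne, h.not_ge,
      QuadraticMap.polar_comm Q (Pi.single j 1)]

section BaseChange

variable (K : Type*) [Field K]

/-- The quadratic form over `K` with the same coefficients as the integral form `Q`. -/
def overField (Q : QuadraticForm ℤ (Fin r → ℤ)) : QuadraticForm K (Fin r → K) :=
  ((upperMatrix Q).map (Int.cast : ℤ → K)).toQuadraticForm'

theorem overField_apply (Q : QuadraticForm ℤ (Fin r → ℤ)) (x : Fin r → K) :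
    overField K Q x = ∑ i, ∑ j ∈ Finset.Ici i, (coeff Q i j : K) * x i * x j := by
  rw [overField, Matrix.toQuadraticForm', LinearMap.BilinMap.toQuadraticMap_apply,
    Matrix.toLinearMap₂'_apply']
  simp only [dotProduct, Matrix.mulVec, Finset.mul_sum]
  refine Finset.sum_congr rfl fun i _ => ?_
  rw [← Finset.sum_subset (Finset.subset_univ (Finset.Ici i))]
  · refine Finset.sum_congr rfl fun j hj => ?_
    simp [upperMatrix, Finset.mem_Ici.1 hj]
    ring
  · intro j _ hj
    have : ¬ i ≤ j := by simpa using hj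
    simp [upperMatrix, this]

theorem overField_intCast (Q : QuadraticForm ℤ (Fin r → ℤ)) (x : Fin r → ℤ) :
    overField K Q (fun i => (x i : K)) = (Q x : K) := by
  rw [overField_apply, apply_eq_sum]
  push_cast
  rfl

theorem polar_overField (Q : QuadraticForm ℤ (Fin r → ℤ)) (x y : Fin r → K) :
    QuadraticMap.polar (overField K Q) x y =
      x ⬝ᵥ Matrix.mulVec ((matrix Q).map (Int.cast : ℤ → K)) y := by
  rw [overField, Matrix.toQuadraticForm', LinearMap.BilinMap.polar_toQuadraticMap,
    Matrix.toLinearMap₂'_apply', Matrix.toLinearMap₂'_apply', ← upperMatrix_add_transpose,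
    Matrix.map_add _ Int.cast_add, Matrix.add_mulVec, dotProduct_add, Matrix.transpose_map,
    Matrix.mulVec_transpose, Matrix.dotProduct_mulVec y, dotProduct_comm x (Matrix.vecMul _ _)]

variable {K}

theorem IsNonsingularOver.exists_polar_ne_zero {Q : QuadraticForm ℤ (Fin r → ℤ)}
    (hQ : IsNonsingularOver K Q) {x : Fin r → K} (hx : x ≠ 0) :
    ∃ w, QuadraticMap.polar (overField K Q) x w ≠ 0 := by
  have h : Matrix.mulVec ((matrix Q).map (Int.cast : ℤ → K)) x ≠ 0 := fun h =>
    hQ (Matrix.exists_mulVec_eq_zero_iff.1 ⟨x, hx, h⟩)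
  obtain ⟨i, hi⟩ := Function.ne_iff.1 h
  refine ⟨Pi.single i 1, ?_⟩
  rwa [QuadraticMap.polar_comm, polar_overField, single_one_dotProduct]

theorem IsNonsingularOver.exists_overField_eq {Q : QuadraticForm ℤ (Fin r → ℤ)}
    (hQ : IsNonsingularOver K Q) {x : Fin r → K} (hx : x ≠ 0) (h0 : overField K Q x = 0) (t : K) :
    ∃ v, overField K Q v = t :=
  let ⟨_, hw⟩ := hQ.exists_polar_ne_zero hx
  QuadraticForm.exists_eq_of_isotropic h0 hw t

theorem isNonsingularOver_iff [CharZero K] {Q : QuadraticForm ℤ (Fin r → ℤ)} :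
    IsNonsingularOver K Q ↔ (matrix Q).det ≠ 0 := by
  rw [IsNonsingularOver, ← Int.cast_det, ne_eq, Int.cast_eq_zero]

end BaseChange

/-! ### Density of the ratio set and ratios of `p`-adic values -/

variable {p : ℕ} [Fact p.Prime]

theorem _root_.Padic.exists_mul_family_norm_le_one {ι : Type*} [Finite ι] (x : ι → ℚ_[p]) :
    ∃ c : ℚ_[p], c ≠ 0 ∧ ∀ i, ‖c * x i‖ ≤ 1 := by
  have := Fintype.ofFinite ι
  obtain ⟨c, hc0, hc⟩ := NormedField.exists_norm_lt ℚ_[p] (r := (‖x‖ + 1)⁻¹) (by positivity)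
  refine ⟨c, norm_pos_iff.1 hc0, fun i => ?_⟩
  rw [norm_mul]
  calc ‖c‖ * ‖x i‖ ≤ (‖x‖ + 1)⁻¹ * (‖x‖ + 1) := by
        gcongr
        exact (norm_le_pi_norm x i).trans (by linarith)
    _ = 1 := inv_mul_cancel₀ (by positivity)

theorem continuous_overField (Q : QuadraticForm ℤ (Fin r → ℤ)) :
    Continuous (overField ℚ_[p] Q) := by
  have : ⇑(overField ℚ_[p] Q) =
      fun x => ∑ i, ∑ j ∈ Finset.Ici i, (coeff Q i j : ℚ_[p]) * x i * x j :=
    funext (overField_apply _ Q)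
  rw [this]
  fun_prop

/-- Since `ℤ` is dense in `ℤ_[p]`, it suffices to obtain every `p`-adic number as a ratio of values of
`Q` at `p`-adic vectors; a common factor makes these integral. -/
theorem ratioSetDense_of_forall_ratio {Q : QuadraticForm ℤ (Fin r → ℤ)}
    (h : ∀ t : ℚ_[p], ∃ x y, overField ℚ_[p] Q y ≠ 0 ∧
      overField ℚ_[p] Q x = t * overField ℚ_[p] Q y) : RatioSetDense p Q := by
  intro t
  rw [mem_closure_iff]
  intro U hU ht
  obtain ⟨x, y, hy, hxy⟩ := h t
  obtain ⟨c, hc0, hc⟩ := Padic.exists_mul_family_norm_le_one (Sum.elim x y)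
  let X : Fin r → ℤ_[p] := fun i => ⟨c * x i, hc (Sum.inl i)⟩
  let Y : Fin r → ℤ_[p] := fun i => ⟨c * y i, hc (Sum.inr i)⟩
  let F : (Fin r → ℤ_[p]) → ℚ_[p] := fun x => overField ℚ_[p] Q fun i => (x i : ℚ_[p])
  have hF : Continuous F := (continuous_overField Q).comp (by fun_prop)
  have hFX : F X = c * c * overField ℚ_[p] Q x := QuadraticMap.map_smul _ c x
  have hFY : F Y = c * c * overField ℚ_[p] Q y := QuadraticMap.map_smul _ c y
  have hFY0 : F Y ≠ 0 := by rw [hFY]; positivity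
  have hXY : F X / F Y = t := by
    rw [hFX, hFY, hxy]; field_simp
  have hcont : ContinuousAt (fun z : (Fin r → ℤ_[p]) × (Fin r → ℤ_[p]) => F z.1 / F z.2) (X, Y) :=
    ContinuousAt.div (by fun_prop) (by fun_prop) hFY0
  have hmem := (hcont.eventually (hU.mem_nhds (show F X / F Y ∈ U from hXY ▸ ht))).and
    ((hF.comp continuous_snd).continuousAt.eventually_ne hFY0)
  have hdense : DenseRange (Prod.map (Pi.map fun _ : Fin r => (Int.cast : ℤ → ℤ_[p]))
      (Pi.map fun _ : Fin r => (Int.cast : ℤ → ℤ_[p]))) :=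
    (DenseRange.piMap fun _ => PadicInt.denseRange_intCast).prodMap
      (DenseRange.piMap fun _ => PadicInt.denseRange_intCast)
  obtain ⟨⟨m, n⟩, hmU, hn⟩ := hdense.mem_nhds hmem
  have hFint (k : Fin r → ℤ) : F (Pi.map (fun _ => Int.cast) k) = (Q k : ℚ_[p]) := by
    rw [← overField_intCast]
    simp [F]
  simp only [Prod.map_apply, Function.comp_apply, hFint] at hmU hn
  exact ⟨_, hmU, _, ⟨m, n, by exact_mod_cast hn, rfl⟩, by push_cast; rfl⟩

/-- The square class of a nonzero `p`-adic number is open. -/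
theorem _root_.Padic.eventually_exists_eq_mul_sq {t : ℚ_[p]} (ht : t ≠ 0) :
    ∀ᶠ s in nhds t, ∃ u : ℚ_[p], u ≠ 0 ∧ s = t * u ^ 2 := by
  have hlim : Filter.Tendsto (fun s => 1 - s / t) (nhds t) (nhds 0) := by
    have : ContinuousAt (fun s => 1 - s / t) t := by fun_prop
    simpa [ContinuousAt, ht] using this
  have hpos : 0 < ‖(2 : ℚ_[p])‖ ^ 2 := pow_pos (norm_pos_iff.2 two_ne_zero) 2
  filter_upwards [hlim.eventually (Metric.ball_mem_nhds 0 hpos), eventually_ne_nhds ht]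
    with s hs hs0
  rw [dist_zero_right] at hs
  have h2 : ‖(2 : ℚ_[p])‖ ≤ 1 := by simpa using Padic.norm_int_le_one (p := p) 2
  have h1 : ‖s / t‖ ≤ 1 := by
    have := Padic.nonarchimedean 1 (-(1 - s / t))
    rw [neg_sub, add_sub_cancel, norm_one, norm_sub_rev] at this
    exact this.trans (max_le le_rfl (hs.le.trans (pow_le_one₀ (norm_nonneg _) h2)))
  obtain ⟨w, hw⟩ := PadicInt.isSquare_of_norm_sub_lt (u := (⟨s / t, h1⟩ : ℤ_[p])) (a := 1)
    (by rw [one_pow, mul_one]; exact hs)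
  have hw' : s / t = w * w := congrArg (fun z : ℤ_[p] => (z : ℚ_[p])) hw
  have hst : s = t * (w : ℚ_[p]) ^ 2 := by rw [sq, ← hw']; field_simp
  exact ⟨w, fun h => hs0 (by rw [hst, h]; simp), hst⟩

/-- A ratio close to `t` lies in `t • (ℚ_[p]ˣ)²`, and a square can be absorbed in the denominator. -/
theorem RatioSetDense.exists_ratio {Q : QuadraticForm ℤ (Fin r → ℤ)} (h : RatioSetDense p Q)
    {t : ℚ_[p]} (ht : t ≠ 0) : ∃ x y, overField ℚ_[p] Q y ≠ 0 ∧
      overField ℚ_[p] Q x = t * overField ℚ_[p] Q y := by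
  obtain ⟨_, ⟨u, hu0, hu⟩, _, ⟨x, y, hy, rfl⟩, rfl⟩ :=
    mem_closure_iff_nhds.1 (h t) _ (Padic.eventually_exists_eq_mul_sq ht)
  have hy' : (Q y : ℚ_[p]) ≠ 0 := by exact_mod_cast hy
  refine ⟨fun i => (x i : ℚ_[p]), u • fun i => (y i : ℚ_[p]), ?_, ?_⟩ <;>
    rw [QuadraticMap.map_smul, overField_intCast, smul_eq_mul]
  · exact mul_ne_zero (mul_ne_zero hu0 hu0) hy'
  · push_cast at hu
    rw [div_eq_iff hy'] at hu
    rw [overField_intCast, hu]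
    ring

theorem ratioSetDense_of_isotropic {Q : QuadraticForm ℤ (Fin r → ℤ)}
    (hQ : IsNonsingularOver ℚ_[p] Q) {x : Fin r → ℚ_[p]} (hx : x ≠ 0)
    (h0 : overField ℚ_[p] Q x = 0) : RatioSetDense p Q := by
  refine ratioSetDense_of_forall_ratio fun t => ?_
  obtain ⟨y, hy⟩ := hQ.exists_overField_eq hx h0 1
  obtain ⟨z, hz⟩ := hQ.exists_overField_eq hx h0 t
  exact ⟨z, y, by simp [hy], by simp [hy, hz]⟩

/-- If `Q` is anisotropic over `ℚ_[p]`, then `t` is a ratio because the form `Q(x) - t Q(y)` in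
`2 r ≥ 6` variables is isotropic. -/
theorem ratioSetDense_of_three_le (hr : 3 ≤ r) {Q : QuadraticForm ℤ (Fin r → ℤ)}
    (hQ : IsNonsingularOver ℚ_[p] Q) : RatioSetDense p Q := by
  by_cases han : (overField ℚ_[p] Q).Anisotropic
  · refine ratioSetDense_of_forall_ratio fun t => ?_
    let q : QuadraticForm ℚ_[p] ((Fin r → ℚ_[p]) × (Fin r → ℚ_[p])) :=
      (overField ℚ_[p] Q).prod (-(t • overField ℚ_[p] Q))
    have hq : ¬ q.Anisotropic := fun h => by
      have := QuadraticForm.finrank_le_four_of_anisotropic h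
      rw [Module.finrank_prod, Module.finrank_fin_fun] at this
      omega
    obtain ⟨⟨x, y⟩, hxy, hne⟩ : ∃ v, q v = 0 ∧ v ≠ 0 := by
      simpa [QuadraticMap.Anisotropic] using hq
    have hxy' : overField ℚ_[p] Q x = t * overField ℚ_[p] Q y := by
      rw [← sub_eq_zero, sub_eq_add_neg]
      simpa [q] using hxy
    refine ⟨x, y, fun hy => hne ?_, hxy'⟩
    rw [hy, mul_zero] at hxy'
    rw [han x hxy', han y hy, Prod.mk_zero_zero]
  · obtain ⟨x, hx0, hx⟩ : ∃ x, overField ℚ_[p] Q x = 0 ∧ x ≠ 0 := by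
      simpa [QuadraticMap.Anisotropic] using han
    exact ratioSetDense_of_isotropic hQ hx hx0

end IntForm

/-! ### Forms `X² - d Y²` with `d` not a square are not universal -/

namespace Padic

variable {p : ℕ} [Fact p.Prime]

/-- Infinite descent: if each solution of `t z² = x² - D y²` in `ℤ_[p]` is divisible by `p`, then `0` is
the only possible `z`. -/
theorem sq_sub_mul_sq_ne_of_forall_dvd {D t : ℤ_[p]}
    (h : ∀ x y z : ℤ_[p], t * z ^ 2 = x ^ 2 - D * y ^ 2 → (p : ℤ_[p]) ∣ x ∧ (p : ℤ_[p]) ∣ y ∧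
      (p : ℤ_[p]) ∣ z) (X Y : ℚ_[p]) : X ^ 2 - D * Y ^ 2 ≠ t := by
  intro hXY
  have hp0 : (p : ℤ_[p]) ≠ 0 := PadicInt.prime_p.ne_zero
  have hpow (n : ℕ) : ∀ x y z : ℤ_[p], t * z ^ 2 = x ^ 2 - D * y ^ 2 → (p : ℤ_[p]) ^ n ∣ z := by
    induction n with
    | zero => intro x y z _; simp
    | succ n ih =>
      intro x y z hxyz
      obtain ⟨⟨x', rfl⟩, ⟨y', rfl⟩, ⟨z', rfl⟩⟩ := h x y z hxyz
      rw [pow_succ']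
      refine mul_dvd_mul_left _ (ih x' y' z' (mul_left_cancel₀ (pow_ne_zero 2 hp0) ?_))
      linear_combination hxyz
  obtain ⟨c, hc0, hc⟩ := exists_mul_family_norm_le_one ![X, Y, 1]
  let x : ℤ_[p] := ⟨c * X, hc 0⟩
  let y : ℤ_[p] := ⟨c * Y, hc 1⟩
  let z : ℤ_[p] := ⟨c, by simpa using hc 2⟩
  have hz0 : z ≠ 0 := fun h => hc0 (congrArg (fun w : ℤ_[p] => (w : ℚ_[p])) h)
  have hxyz : t * z ^ 2 = x ^ 2 - D * y ^ 2 := by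
    apply PadicInt.ext
    push_cast
    simp only [x, y, z]
    linear_combination -c ^ 2 * hXY
  obtain ⟨n, hn⟩ := FiniteMultiplicity.of_prime_left PadicInt.prime_p hz0
  exact hn (hpow _ x y z hxyz)

/-- The condition `4 * x = 0` says that `x` is even. -/
theorem zmod_eight_dvd : ∀ D : ZMod 8, 2 * D = 0 ∨ D = 1 ∨ ∃ t : ZMod 8,
    t ≠ 0 ∧ ∀ x y z : ZMod 8, t * z ^ 2 = x ^ 2 - D * y ^ 2 →
      4 * x = 0 ∧ 4 * y = 0 ∧ 4 * z = 0 := by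
  decide +kernel

theorem toZMod_eq_zero_iff (z : ℤ_[p]) : PadicInt.toZMod z = 0 ↔ (p : ℤ_[p]) ∣ z := by
  rw [← RingHom.mem_ker, PadicInt.ker_toZMod, PadicInt.maximalIdeal_eq_span_p,
    Ideal.mem_span_singleton]

/-- If `D` is `0` or `4` modulo `8` it is divisible by `4`, and if it is `1` it is a square; the
other residues are settled by `zmod_eight_dvd`. -/
theorem exists_forall_dvd_of_two {D : ℤ_[2]} (hD : ¬ (2 : ℤ_[2]) ^ 2 ∣ D) (hsq : ¬ IsSquare D) :
    ∃ t : ℤ_[2], t ≠ 0 ∧ ∀ x y z : ℤ_[2], t * z ^ 2 = x ^ 2 - D * y ^ 2 →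
      (2 : ℤ_[2]) ∣ x ∧ (2 : ℤ_[2]) ∣ y ∧ (2 : ℤ_[2]) ∣ z := by
  let φ : ℤ_[2] →+* ZMod 8 := PadicInt.toZModPow (p := 2) 3
  have hφ (z : ℤ_[2]) : φ z = 0 ↔ (2 : ℤ_[2]) ^ 3 ∣ z := by
    rw [← Ideal.mem_span_singleton]
    have := PadicInt.ker_toZModPow (p := 2) 3
    rw [Nat.cast_ofNat] at this
    rw [← this]; rfl
  have h2 : (2 : ℤ_[2]) ≠ 0 := two_ne_zero
  have hdvd (z : ℤ_[2]) (h : 4 * φ z = 0) : (2 : ℤ_[2]) ∣ z := by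
    rw [← map_ofNat φ 4, ← map_mul, hφ] at h
    refine (mul_dvd_mul_iff_left (pow_ne_zero 2 h2)).1 ?_
    convert h using 1 <;> ring
  rcases zmod_eight_dvd (φ D) with h | h | ⟨t, ht0, ht⟩
  · refine absurd ?_ hD
    rw [← map_ofNat φ 2, ← map_mul, hφ] at h
    refine (mul_dvd_mul_iff_left h2).1 ?_
    convert h using 1; ring
  · refine absurd (PadicInt.isSquare_of_norm_sub_lt (a := 1) ?_) hsq
    have h8 : (2 : ℤ_[2]) ^ 3 ∣ 1 ^ 2 - D := by rw [← hφ]; simp [h]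
    obtain ⟨e, he⟩ := h8
    have hn : ‖(2 : ℤ_[2])‖ = 2⁻¹ := by simpa using PadicInt.norm_p (p := 2)
    rw [he, mul_one, norm_mul, norm_pow, hn]
    have := PadicInt.norm_le_one e
    norm_num; linarith
  · obtain ⟨s, rfl⟩ := ZMod.ringHom_surjective φ t
    refine ⟨s, fun h => ht0 (by rw [h, map_zero]), fun x y z h => ?_⟩
    obtain ⟨hx, hy, hz⟩ := ht (φ x) (φ y) (φ z) (by simpa using congrArg φ h)
    exact ⟨hdvd x hx, hdvd y hy, hdvd z hz⟩

/-- For `p ∣ D` a unit `t` that is not a square modulo `p` serves; otherwise `D` is not a square modulo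
`p` and `t = p` serves. -/
theorem exists_forall_dvd_of_ne_two (hp2 : p ≠ 2) {D : ℤ_[p]} (hD : ¬ (p : ℤ_[p]) ^ 2 ∣ D)
    (hsq : ¬ IsSquare D) :
    ∃ t : ℤ_[p], t ≠ 0 ∧ ∀ x y z : ℤ_[p], t * z ^ 2 = x ^ 2 - D * y ^ 2 →
      (p : ℤ_[p]) ∣ x ∧ (p : ℤ_[p]) ∣ y ∧ (p : ℤ_[p]) ∣ z := by
  have hp : Prime (p : ℤ_[p]) := PadicInt.prime_p
  by_cases hpD : (p : ℤ_[p]) ∣ D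
  · obtain ⟨u, rfl⟩ := hpD
    obtain ⟨e, he⟩ := FiniteField.exists_nonsquare (F := ZMod p) (by rwa [ZMod.ringChar_zmod_n])
    obtain ⟨t, rfl⟩ := ZMod.ringHom_surjective (PadicInt.toZMod (p := p)) e
    refine ⟨t, fun h => he (by simp [h]), fun x y z h => ?_⟩
    have hmod := congrArg PadicInt.toZMod h
    simp only [map_mul, map_pow, map_sub, map_natCast, CharP.cast_eq_zero, zero_mul,
      sub_zero] at hmod
    have hz : PadicInt.toZMod z = 0 := by
      by_contra hz
      refine he ⟨PadicInt.toZMod x / PadicInt.toZMod z, ?_⟩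
      field_simp
      linear_combination hmod
    have hx : PadicInt.toZMod x = 0 := by
      rw [hz] at hmod
      simpa using hmod.symm
    rw [toZMod_eq_zero_iff] at hx hz
    obtain ⟨x', rfl⟩ := hx
    obtain ⟨z', rfl⟩ := hz
    have hy : (p : ℤ_[p]) ∣ u * y ^ 2 :=
      ⟨x' ^ 2 - t * z' ^ 2, mul_left_cancel₀ hp.ne_zero (by linear_combination h)⟩
    refine ⟨dvd_mul_right _ _, ?_, dvd_mul_right _ _⟩
    refine hp.dvd_of_dvd_pow ((hp.dvd_or_dvd hy).resolve_left fun hu => hD ?_)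
    rw [sq]
    exact mul_dvd_mul_left _ hu
  · have hDsq : ¬ IsSquare (PadicInt.toZMod D) := by
      rintro ⟨a, ha⟩
      obtain ⟨b, rfl⟩ := ZMod.ringHom_surjective (PadicInt.toZMod (p := p)) a
      refine hsq (PadicInt.isSquare_of_norm_sub_lt (a := b) ?_)
      have h2b : ¬ (p : ℤ_[p]) ∣ 2 * b := by
        rw [← toZMod_eq_zero_iff, map_mul, map_ofNat, mul_eq_zero, not_or]
        refine ⟨fun h => ?_, fun h => hpD ?_⟩
        · exact Ring.two_ne_zero (R := ZMod p) (by rwa [ZMod.ringChar_zmod_n]) h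
        · rw [← toZMod_eq_zero_iff, ha, h, mul_zero]
      rw [← PadicInt.norm_lt_one_iff_dvd, not_lt] at h2b
      rw [le_antisymm (PadicInt.norm_le_one _) h2b, one_pow, PadicInt.norm_lt_one_iff_dvd,
        ← toZMod_eq_zero_iff, map_sub, map_pow, ha]
      ring
    refine ⟨p, hp.ne_zero, fun x y z h => ?_⟩
    have hmod := congrArg PadicInt.toZMod h
    simp only [map_mul, map_pow, map_sub, map_natCast, CharP.cast_eq_zero, zero_mul] at hmod
    have hy : PadicInt.toZMod y = 0 := by
      by_contra hy
      refine hDsq ⟨PadicInt.toZMod x / PadicInt.toZMod y, ?_⟩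
      field_simp
      linear_combination hmod
    have hx : PadicInt.toZMod x = 0 := by
      rw [hy] at hmod
      simpa using hmod.symm
    rw [toZMod_eq_zero_iff] at hx hy
    obtain ⟨x', rfl⟩ := hx
    obtain ⟨y', rfl⟩ := hy
    refine ⟨dvd_mul_right _ _, dvd_mul_right _ _, hp.dvd_of_dvd_pow (n := 2)
      ⟨x' ^ 2 - D * y' ^ 2, mul_left_cancel₀ hp.ne_zero (by linear_combination h)⟩⟩

/-- The norm form of a quadratic extension of `ℚ_[p]` is not universal. -/
theorem exists_sq_sub_mul_sq_ne {d : ℚ_[p]} (hd : ¬ IsSquare d) :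
    ∃ t : ℚ_[p], t ≠ 0 ∧ ∀ X Y : ℚ_[p], X ^ 2 - d * Y ^ 2 ≠ t := by
  have hd0 : d ≠ 0 := fun h => hd (h ▸ IsSquare.zero)
  have hp0 : (p : ℚ_[p]) ≠ 0 := by exact_mod_cast (Fact.out : p.Prime).ne_zero
  -- modulo squares, `d` is an integer of valuation `0` or `1`
  set k : ℤ := d.valuation / 2 with hk
  set e : ℚ_[p] := d * ((p : ℚ_[p]) ^ (-k)) ^ 2 with he
  have hpk : (p : ℚ_[p]) ^ (-k) ≠ 0 := zpow_ne_zero _ hp0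
  have he0 : e ≠ 0 := mul_ne_zero hd0 (pow_ne_zero 2 hpk)
  have hval : e.valuation = d.valuation % 2 := by
    rw [he, valuation_mul hd0 (pow_ne_zero 2 hpk), valuation_pow, valuation_zpow, valuation_p]
    push_cast
    omega
  have hp1 : (1 : ℝ) < p := by exact_mod_cast (Fact.out : p.Prime).one_lt
  have hnorm : ‖e‖ = (p : ℝ) ^ (-e.valuation) := norm_eq_zpow_neg_valuation he0
  let D : ℤ_[p] := ⟨e, by
    rw [hnorm]; exact zpow_le_one_of_nonpos₀ hp1.le (by omega)⟩
  have hdD (Y : ℚ_[p]) : d * Y ^ 2 = D * ((p : ℚ_[p]) ^ k * Y) ^ 2 := by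
    have : (p : ℚ_[p]) ^ (-k) * (p : ℚ_[p]) ^ k = 1 := by rw [← zpow_add₀ hp0]; simp
    simp only [D, he]
    linear_combination -d * Y ^ 2 * ((p : ℚ_[p]) ^ (-k) * (p : ℚ_[p]) ^ k + 1) * this
  have hsq : ¬ IsSquare D := by
    rintro ⟨w, hw⟩
    refine hd ⟨w * (p : ℚ_[p]) ^ k, ?_⟩
    have := hdD 1
    rw [hw] at this
    push_cast at this
    linear_combination this
  have hdvd : ¬ (p : ℤ_[p]) ^ 2 ∣ D := by
    rintro ⟨w, hw⟩
    have h1 : ‖D‖ ≤ (p : ℝ) ^ (-2 : ℤ) := by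
      rw [hw, norm_mul, PadicInt.norm_p_pow]
      exact mul_le_of_le_one_right (by positivity) (PadicInt.norm_le_one w)
    rw [PadicInt.norm_def, hnorm, zpow_le_zpow_iff_right₀ hp1] at h1
    omega
  obtain ⟨t, ht0, ht⟩ : ∃ t : ℤ_[p], t ≠ 0 ∧ ∀ x y z : ℤ_[p], t * z ^ 2 = x ^ 2 - D * y ^ 2 →
      (p : ℤ_[p]) ∣ x ∧ (p : ℤ_[p]) ∣ y ∧ (p : ℤ_[p]) ∣ z := by
    clear_value D
    clear * - hdvd hsq
    by_cases hp2 : p = 2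
    · subst hp2
      exact exists_forall_dvd_of_two (by simpa using hdvd) hsq
    · exact exists_forall_dvd_of_ne_two hp2 hdvd hsq
  refine ⟨t, fun h => ht0 (PadicInt.ext h), fun X Y => ?_⟩
  rw [hdD]
  exact sq_sub_mul_sq_ne_of_forall_dvd ht X _

end Padic

/-! ### Binary forms -/

namespace IntForm

variable {p : ℕ} [Fact p.Prime]

theorem overField_two (K : Type*) [Field K] (Q : QuadraticForm ℤ (Fin 2 → ℤ)) (x : Fin 2 → K) :
    overField K Q x = coeff Q 0 0 * x 0 ^ 2 + coeff Q 0 1 * x 0 * x 1 + coeff Q 1 1 * x 1 ^ 2 := by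
  have h0 : Finset.Ici (0 : Fin 2) = {0, 1} := rfl
  have h1 : Finset.Ici (1 : Fin 2) = {1} := rfl
  rw [overField_apply, Fin.sum_univ_two, h0, h1]
  simp
  ring

/-- The isotropic vector is given by the root `(-b + √(b² - 4ac)) / 2a` of `a X² + b X + c`. -/
theorem exists_isotropic_of_isSquare_discriminant (K : Type*) [Field K] [CharZero K]
    {Q : QuadraticForm ℤ (Fin 2 → ℤ)} (h : IsSquare ((discriminant Q : ℤ) : K)) :
    ∃ x : Fin 2 → K, x ≠ 0 ∧ overField K Q x = 0 := by
  obtain ⟨s, hs⟩ := h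
  rw [discriminant] at hs
  push_cast at hs
  by_cases ha : (coeff Q 0 0 : K) = 0
  · exact ⟨![1, 0], fun h => one_ne_zero (congrFun h 0), by simp [overField_two, ha]⟩
  · refine ⟨![s - coeff Q 0 1, 2 * coeff Q 0 0], fun h => ?_, ?_⟩
    · exact mul_ne_zero two_ne_zero ha (congrFun h 1)
    · simp only [overField_two, Matrix.cons_val_zero, Matrix.cons_val_one]
      linear_combination -(coeff Q 0 0 : K) * hs

theorem four_mul_coeff_mul_overField (K : Type*) [Field K] (Q : QuadraticForm ℤ (Fin 2 → ℤ))
    (x : Fin 2 → K) : 4 * (coeff Q 0 0 : K) * overField K Q x =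
      (2 * coeff Q 0 0 * x 0 + coeff Q 0 1 * x 1) ^ 2 - (discriminant Q : ℤ) * x 1 ^ 2 := by
  rw [overField_two, discriminant]
  push_cast
  ring

/-- Up to the factor `4a`, the values of `Q` have the form `X² - d Y²`. Such numbers are closed under
ratios, so density of the ratio set would make `X² - d Y²` universal. -/
theorem RatioSetDense.isSquare_discriminant {Q : QuadraticForm ℤ (Fin 2 → ℤ)}
    (h : RatioSetDense p Q) : IsSquare ((discriminant Q : ℤ) : ℚ_[p]) := by
  by_contra hd
  obtain ⟨t, ht0, ht⟩ := Padic.exists_sq_sub_mul_sq_ne hd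
  obtain ⟨x, y, hy, hxy⟩ := h.exists_ratio ht0
  -- for `a = 0` the discriminant would be the square `b²`
  have ha : (coeff Q 0 0 : ℚ_[p]) ≠ 0 := fun ha => hd ⟨coeff Q 0 1, by
    rw [discriminant]; push_cast; rw [ha]; ring⟩
  have hx := four_mul_coeff_mul_overField ℚ_[p] Q x
  have hy' := four_mul_coeff_mul_overField ℚ_[p] Q y
  have hN : 4 * (coeff Q 0 0 : ℚ_[p]) * overField ℚ_[p] Q y ≠ 0 :=
    mul_ne_zero (mul_ne_zero (by norm_num) ha) hy
  rw [hxy] at hx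
  set N := 4 * (coeff Q 0 0 : ℚ_[p]) * overField ℚ_[p] Q y with hNdef
  set A := 2 * (coeff Q 0 0 : ℚ_[p]) * x 0 + coeff Q 0 1 * x 1
  set C := 2 * (coeff Q 0 0 : ℚ_[p]) * y 0 + coeff Q 0 1 * y 1
  set d := ((discriminant Q : ℤ) : ℚ_[p])
  have hx' : t * N = A ^ 2 - d * x 1 ^ 2 := by rw [← hx, hNdef]; ring
  -- `(A² - d x₁²) / (C² - d y₁²)` is the norm of `(A + √d x₁)(C + √d y₁) / N`
  refine ht ((A * C + d * x 1 * y 1) / N) ((A * y 1 + x 1 * C) / N) ?_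
  have : (A * C + d * x 1 * y 1) ^ 2 - d * (A * y 1 + x 1 * C) ^ 2 = t * N ^ 2 := by
    linear_combination (-(C ^ 2 - d * y 1 ^ 2)) * hx' - t * N * hy'
  rw [div_pow, div_pow, ← mul_div_assoc, ← sub_div, this,
    mul_div_cancel_right₀ _ (pow_ne_zero 2 hN)]

end IntForm

theorem theorem1p1 (p : ℕ) [Fact p.Prime] :
    (∀ Q : QuadraticForm ℤ (Fin 2 → ℤ),
      IntForm.IsPrimitive Q → IntForm.IsNonsingularOver ℚ Q →
        (IntForm.RatioSetDense p Q ↔ IsSquare ((IntForm.discriminant Q : ℤ) : ℚ_[p]))) ∧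
    (∀ r : ℕ, 3 ≤ r → ∀ Q : QuadraticForm ℤ (Fin r → ℤ),
      IntForm.IsPrimitive Q → IntForm.IsNonsingularOver ℚ Q →
        IntForm.RatioSetDense p Q) := by
  have base {r : ℕ} {Q : QuadraticForm ℤ (Fin r → ℤ)} (hQ : IntForm.IsNonsingularOver ℚ Q) :
      IntForm.IsNonsingularOver ℚ_[p] Q :=
    IntForm.isNonsingularOver_iff.2 (IntForm.isNonsingularOver_iff.1 hQ)
  refine ⟨fun Q _ hQ => ⟨fun h => h.isSquare_discriminant, fun h => ?_⟩,
    fun r hr Q _ hQ => IntForm.ratioSetDense_of_three_le hr (base hQ)⟩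
  obtain ⟨x, hx, hx0⟩ := IntForm.exists_isotropic_of_isSquare_discriminant ℚ_[p] h
  exact IntForm.ratioSetDense_of_isotropic (base hQ) hx hx0
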